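/- **Theorem (Enlargement property).** Fix an LE-signature $\mathcal L=(\mathcal F,\mathcal G)$: two disjoint families of connectives, each connective $h$ having a finite arity $n_h\ge 0$ and an order type $\epsilon_h\in\{1,\partial\}^{n_h}$. For sets $W,U$ put $W^{1}=U^{\partial}=W$, $W^{\partial}=U^{1}=U$ and $W^{\epsilon}=\prod_i W^{\epsilon(i)}$, $U^{\epsilon}=\prod_i U^{\epsilon(i)}$. For a relation $R\subseteq A\times B_1\times\dots\times B_n$ and $C_i\subseteq B_i$ put $R^{(0)}[\overline C]=\{a\mid R(a,\overline b)\text{ for all }\overline b\in\prod_i C_i\}$; for a relation $R\subseteq A\times B$ and $A'\subseteq A$ put $R^{(1)}[A']=\{b\mid R(a,b)\text{ for all }a\in A'\}$ (a point stands for its singleton). *Frames.* An $\mathcal L$-frame $\mathbb F=(W,U,N,(R_f)_{f\in\mathcal F},(R_g)_{g\in\mathcal G})$ consists of sets $W,U$ and relations $N\subseteq W\times U$, $R_f\subseteq U\times W^{\epsilon_f}$, $R_g\subseteq W\times U^{\epsilon_g}$ such that every set obtained from some $R_f$ or $R_g$ by fixing all arguments but one is Galois-stable, i.e. closed for the Galois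 connection $X\mapsto X^{\uparrow}=\{u\mid xNu\ \forall x\in X\}$, $Y\mapsto Y^{\downarrow}=\{w\mid wNy\ \forall y\in Y\}$. *Complex algebra.* $\mathbb F^+$ is the concept lattice of $(W,U,N)$, with elements $c=([\![c]\!],(\!|c|\!))$, $(\!|c|\!)=[\![c]\!]^{\uparrow}$, $[\![c]\!]=(\!|c|\!)^{\downarrow}$, ordered by inclusion of extents $[\![c]\!]$, with the operations: $f(\overline c)$ is the concept with intent $R_f^{(0)}[\overline{[\![c]\!]}^{\epsilon_f}]$ and $g(\overline c)$ is the concept with extent $R_g^{(0)}[\overline{(\!|c|\!)}^{\epsilon_g}]$, where $[\![c]\!]^{1}=(\!|c|\!)^{\partial}=[\![c]\!]$ and $[\![c]\!]^{\partial}=(\!|c|\!)^{1}=(\!|c|\!)$. *Filter-ideal extension.* $\mathbb F^\star_{\mathbb F^+}$ is the $\mathcal L$-frame whose sorts are the set $\mathfrak F$ of all (nonempty, possibly improper) filters and the set $\mathfrak I$ of all (nonempty, possibly improper) ideals of $\mathbb F^+$, with $H\,N^\star I$ iff $H\cap I\ne\varnothing$; $R^\star_f(I,\overline H)$ iff $f(\overline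 a)\in I$ for some $\overline a\in\overline H$; $R^\star_g(H,\overline I)$ iff $g(\overline a)\in H$ for some $\overline a\in\overline I$. *Ultrapower.* $\mathbb F^J/\mathcal U$ is the $\mathcal L$-frame on $W^J/\mathcal U$ and $U^J/\mathcal U$ in which each of $N,R_f,R_g$ holds of given classes iff it holds of their representatives at $\mathcal U$-almost every $j\in J$. *p-morphisms.* A p-morphism $(S,T):\mathbb F_1\to\mathbb F_2$ is a pair of relations $S\subseteq W_1\times U_2$, $T\subseteq U_1\times W_2$ such that $S^{(0)}[u]$, $S^{(1)}[w]$, $T^{(0)}[w']$, $T^{(1)}[u']$ are Galois-stable for all $u\in U_2$, $w\in W_1$, $w'\in W_2$, $u'\in U_1$; $(T^{(0)}[w])^{\downarrow}\subseteq S^{(0)}[w^{\uparrow}]$ for $w\in W_2$; $T^{(0)}[(S^{(1)}[w])^{\downarrow}]\subseteq w^{\uparrow}$ for $w\in W_1$; and for all $f$, $\overline w\in W_2^{\epsilon_f}$, $g$, $\overline u\in U_2^{\epsilon_g}$, $$T^{(0)}\big[((R^2_f)^{(0)}[\overline w])^{\downarrow}\big]=(R^1_f)^{(0)}[\overline X],\qquad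 S^{(0)}\big[((R^2_g)^{(0)}[\overline u])^{\uparrow}\big]=(R^1_g)^{(0)}[\overline Y],$$ where $X_i=(T^{(0)}[w_i])^{\downarrow}$ if $\epsilon_f(i)=1$ and $X_i=(S^{(0)}[w_i])^{\uparrow}$ if $\epsilon_f(i)=\partial$, and $Y_i=(S^{(0)}[u_i])^{\uparrow}$ if $\epsilon_g(i)=1$ and $Y_i=(T^{(0)}[u_i])^{\downarrow}$ if $\epsilon_g(i)=\partial$. It is *surjective*, and then $\mathbb F_2$ is a *p-morphic image* of $\mathbb F_1$, if $S^{(0)}[(\!|a|\!)]\ne S^{(0)}[(\!|b|\!)]$ for all $a\neq b$ in $\mathbb F_2^+$. **Claim.** For every $\mathcal L$-frame $\mathbb F$ there are a set $J$ and an ultrafilter $\mathcal U$ on $J$ such that $\mathbb F^\star_{\mathbb F^+}$ is a p-morphic image of $\mathbb F^J/\mathcal U$; moreover, the surjective p-morphism $(S,T):\mathbb F^J/\mathcal U\twoheadrightarrow\mathbb F^\star_{\mathbb F^+}$ can be taken to be the pair $$[s]\,S\,I\iff \{j\mid s(j)\in[\![c]\!]\}\in\mathcal U\text{ for some }c\in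 I,\qquad [t]\,T\,H\iff \{j\mid t(j)\in(\!|c|\!)\}\in\mathcal U\text{ for some }c\in H.$$ -/

import Mathlib

universe u v

namespace LELogic

/-! ### Order types and signatures -/

/-- The two values `1` and `∂` of an order type. -/
inductive OSign where
  | one
  | dual

/-- The opposite value: `1` and `∂` are exchanged. -/
def OSign.op : OSign → OSign
  | .one => .dual
  | .dual => .one

/-- An LE-signature: two disjoint families of connectives (of arbitrary cardinality), each connective
with a finite arity (possibly `0`) and an order type over that arity. -/
structure LESignature where
  F : Type v
  G : Type v
  arF : F → ℕ
  arG : G → ℕ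
  epsF : ∀ f : F, Fin (arF f) → OSign
  epsG : ∀ g : G, Fin (arG g) → OSign

/-! ### Normal lattice expansions -/

section SignedLattice

variable {A : Type u} [Lattice A]

/-- The order of `A^e`. -/
def leAt : OSign → A → A → Prop
  | .one, x, y => x ≤ y
  | .dual, x, y => y ≤ x

/-- The join of `A^e`. -/
def joinAt : OSign → A → A → A
  | .one, x, y => x ⊔ y
  | .dual, x, y => x ⊓ y

/-- The meet of `A^e`. -/
def meetAt : OSign → A → A → A
  | .one, x, y => x ⊓ y
  | .dual, x, y => x ⊔ y

/-- The least element of `A^e`. -/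
def botAt [BoundedOrder A] : OSign → A
  | .one => ⊥
  | .dual => ⊤

/-- The greatest element of `A^e`. -/
def topAt [BoundedOrder A] : OSign → A
  | .one => ⊤
  | .dual => ⊥

end SignedLattice

/-- The structure of a (normal) `L`-algebra on a bounded lattice `A`: each `f` preserves finite
joins, as a map `A^ε → A`, in each coordinate (joins are preserved where `ε i = 1`, meets are
turned into joins where `ε i = ∂`), and each `g` dually preserves finite meets. -/
structure LEAlgebra (L : LESignature.{v}) (A : Type u) [Lattice A] [BoundedOrder A] where
  opF : ∀ f : L.F, (Fin (L.arF f) → A) → A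
  opG : ∀ g : L.G, (Fin (L.arG g) → A) → A
  opF_join : ∀ (f : L.F) (a : Fin (L.arF f) → A) (i : Fin (L.arF f)) (x y : A),
    opF f (Function.update a i (joinAt (L.epsF f i) x y)) =
      opF f (Function.update a i x) ⊔ opF f (Function.update a i y)
  opF_bot : ∀ (f : L.F) (a : Fin (L.arF f) → A) (i : Fin (L.arF f)),
    opF f (Function.update a i (botAt (L.epsF f i))) = ⊥
  opG_meet : ∀ (g : L.G) (a : Fin (L.arG g) → A) (i : Fin (L.arG g)) (x y : A),
    opG g (Function.update a i (meetAt (L.epsG g i) x y)) =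
      opG g (Function.update a i x) ⊓ opG g (Function.update a i y)
  opG_top : ∀ (g : L.G) (a : Fin (L.arG g) → A) (i : Fin (L.arG g)),
    opG g (Function.update a i (topAt (L.epsG g i))) = ⊤

/-! ### Polarities and frames -/

/-- `W^e` for a polarity with sorts `W` and `U`: it is `W` for `e = 1` and `U` for `e = ∂`.
`U^e` is `Coord W U e.op`. -/
abbrev Coord (W U : Type u) : OSign → Type u
  | .one => W
  | .dual => U

/-- Galois-stable subsets of `W` (for `e = 1`) or of `U` (for `e = ∂`). -/
def Stable {W U : Type u} (N : W → U → Prop) : (e : OSign) → Set (Coord W U e) → Prop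
  | .one, X => lowerPolar N (upperPolar N X) = X
  | .dual, Y => upperPolar N (lowerPolar N Y) = Y

/-- `R⁽⁰⁾[C₁, …, Cₙ] = {x | R x b for all b ∈ C₁ × ⋯ × Cₙ}`. -/
def rel0 {X : Type u} {n : ℕ} {Y : Fin n → Type u} (R : X → (∀ i, Y i) → Prop)
    (C : ∀ i, Set (Y i)) : Set X :=
  {x | ∀ b : ∀ i, Y i, (∀ i, b i ∈ C i) → R x b}

/-- An `L`-frame: a polarity `(W, U, N)` with relations `R_f ⊆ U × W^ε` and `R_g ⊆ W × U^ε` all of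
whose sections `R⁽⁰⁾[b]` and `R⁽ⁱ⁾[x, b^i]` are Galois-stable. -/
structure LEFrame (L : LESignature.{v}) where
  W : Type u
  U : Type u
  N : W → U → Prop
  RF : ∀ f : L.F, U → (∀ i, Coord W U (L.epsF f i)) → Prop
  RG : ∀ g : L.G, W → (∀ i, Coord W U (L.epsG g i).op) → Prop
  RF_stable_zero : ∀ (f : L.F) (b : ∀ i, Coord W U (L.epsF f i)),
    Stable N .dual {x : U | RF f x b}
  RF_stable : ∀ (f : L.F) (x : U) (b : ∀ i, Coord W U (L.epsF f i)) (i : Fin (L.arF f)),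
    Stable N (L.epsF f i) {y | RF f x (Function.update b i y)}
  RG_stable_zero : ∀ (g : L.G) (b : ∀ i, Coord W U (L.epsG g i).op),
    Stable N .one {x : W | RG g x b}
  RG_stable : ∀ (g : L.G) (x : W) (b : ∀ i, Coord W U (L.epsG g i).op) (i : Fin (L.arG g)),
    Stable N (L.epsG g i).op {y | RG g x (Function.update b i y)}

/-! ### Complex algebras -/

/-- For a concept `a`, the extent of `a` if `e = 1` and the intent of `a` if `e = ∂`. -/
def side {W U : Type u} {N : W → U → Prop} (a : Concept W U N) :
    (e : OSign) → Set (Coord W U e)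
  | .one => a.extent
  | .dual => a.intent

theorem side_update {W U : Type u} {N : W → U → Prop} {n : ℕ} {e : Fin n → OSign}
    {X : Type u} (R : X → (∀ i, Coord W U (e i)) → Prop)
    (a : Fin n → Concept W U N) (i : Fin n) (p : Concept W U N) (x : X) :
    x ∈ rel0 R (fun j => side (Function.update a i p j) (e j)) ↔
      ∀ b : ∀ j, Coord W U (e j), (∀ j, j ≠ i → b j ∈ side (a j) (e j)) →
        side p (e i) ⊆ {y | R x (Function.update b i y)} := by
  constructor
  · intro h b hb y hy
    refine h _ fun j => ?_
    by_cases hj : j = i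
    · subst hj; simpa using hy
    · simpa [hj] using hb j hj
  · intro h b hb
    have := h b (fun j hj => by simpa [hj] using hb j) (show b i ∈ side p (e i) by
      simpa using hb i)
    simpa using this

theorem stable_join {W U : Type u} {N : W → U → Prop} (e : OSign) (p q : Concept W U N)
    (Z : Set (Coord W U e)) (hZ : Stable N e Z) :
    side (joinAt e p q) e ⊆ Z ↔ side p e ⊆ Z ∧ side q e ⊆ Z := by
  cases e with
  | one =>
    change lowerPolar N (upperPolar N Z) = Z at hZ
    let c : Concept W U N := ⟨Z, upperPolar N Z, rfl, hZ⟩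
    exact sup_le_iff (a := p) (b := q) (c := c)
  | dual =>
    change upperPolar N (lowerPolar N Z) = Z at hZ
    let c : Concept W U N := ⟨lowerPolar N Z, Z, hZ, rfl⟩
    have h : c ≤ p ⊓ q ↔ c ≤ p ∧ c ≤ q := le_inf_iff
    rw [← Concept.intent_subset_intent_iff, ← Concept.intent_subset_intent_iff,
      ← Concept.intent_subset_intent_iff] at h
    exact h

theorem stable_bot {W U : Type u} {N : W → U → Prop} (e : OSign)
    (Z : Set (Coord W U e)) (hZ : Stable N e Z) :
    side (botAt e : Concept W U N) e ⊆ Z := by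
  cases e with
  | one =>
    change lowerPolar N (upperPolar N Z) = Z at hZ
    let c : Concept W U N := ⟨Z, upperPolar N Z, rfl, hZ⟩
    exact bot_le (a := c)
  | dual =>
    change upperPolar N (lowerPolar N Z) = Z at hZ
    let c : Concept W U N := ⟨lowerPolar N Z, Z, hZ, rfl⟩
    have h := le_top (a := c)
    rwa [← Concept.intent_subset_intent_iff] at h

theorem rel0_join {W U : Type u} {N : W → U → Prop} {n : ℕ} {e : Fin n → OSign}
    {X : Type u} {R : X → (∀ i, Coord W U (e i)) → Prop}
    (hR : ∀ x b i, Stable N (e i) {y | R x (Function.update b i y)})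
    (a : Fin n → Concept W U N) (i : Fin n) (p q : Concept W U N) :
    rel0 R (fun j => side (Function.update a i (joinAt (e i) p q) j) (e j)) =
      rel0 R (fun j => side (Function.update a i p j) (e j)) ∩
        rel0 R (fun j => side (Function.update a i q j) (e j)) := by
  ext x
  rw [Set.mem_inter_iff, side_update, side_update, side_update]
  simp only [stable_join _ _ _ _ (hR x _ i)]
  exact ⟨fun h => ⟨fun b hb => (h b hb).1, fun b hb => (h b hb).2⟩,
    fun h b hb => ⟨h.1 b hb, h.2 b hb⟩⟩

theorem rel0_bot {W U : Type u} {N : W → U → Prop} {n : ℕ} {e : Fin n → OSign}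
    {X : Type u} {R : X → (∀ i, Coord W U (e i)) → Prop}
    (hR : ∀ x b i, Stable N (e i) {y | R x (Function.update b i y)})
    (a : Fin n → Concept W U N) (i : Fin n) :
    rel0 R (fun j => side (Function.update a i (botAt (e i)) j) (e j)) = Set.univ := by
  ext x
  rw [side_update]
  simp only [Set.mem_univ, iff_true]
  exact fun b _ => stable_bot _ _ (hR x b i)

theorem rel0_stable_one {W U : Type u} {N : W → U → Prop} {n : ℕ} {Y : Fin n → Type u}
    {R : W → (∀ i, Y i) → Prop} (hR : ∀ b, Stable N .one {x | R x b}) (C : ∀ i, Set (Y i)) :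
    lowerPolar N (upperPolar N (rel0 R C)) = rel0 R C := by
  refine subset_antisymm (fun x hx b hb => ?_) (subset_lowerPolar_upperPolar N _)
  have h : lowerPolar N (upperPolar N {x | R x b}) = {x | R x b} := hR b
  have hx' : x ∈ lowerPolar N (upperPolar N {x | R x b}) :=
    lowerPolar_upperPolar_monotone N (fun y (hy : y ∈ rel0 R C) => hy b hb) hx
  rwa [h] at hx'

theorem rel0_stable_dual {W U : Type u} {N : W → U → Prop} {n : ℕ} {Y : Fin n → Type u}
    {R : U → (∀ i, Y i) → Prop} (hR : ∀ b, Stable N .dual {x | R x b}) (C : ∀ i, Set (Y i)) :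
    upperPolar N (lowerPolar N (rel0 R C)) = rel0 R C := by
  refine subset_antisymm (fun x hx b hb => ?_) (subset_upperPolar_lowerPolar N _)
  have h : upperPolar N (lowerPolar N {x | R x b}) = {x | R x b} := hR b
  have hx' : x ∈ upperPolar N (lowerPolar N {x | R x b}) :=
    upperPolar_lowerPolar_monotone N (fun y (hy : y ∈ rel0 R C) => hy b hb) hx
  rwa [h] at hx'

theorem meetAt_eq {A : Type u} [Lattice A] (e : OSign) (x y : A) :
    meetAt e x y = joinAt e.op x y := by
  cases e <;> rfl

theorem topAt_eq {A : Type u} [Lattice A] [BoundedOrder A] (e : OSign) :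
    (topAt e : A) = botAt e.op := by
  cases e <;> rfl

/-- The concept lattice of the polarity of a frame. -/
abbrev LEFrame.Cpx {L : LESignature.{v}} (F : LEFrame.{u, v} L) : Type u :=
  Concept F.W F.U F.N

/-- The complex algebra of a frame: `f(a)` is the concept with intent `R_f⁽⁰⁾[⟦a⟧^ε]`, and `g(a)` is
the concept with extent `R_g⁽⁰⁾[⦇a⦈^ε]`, where `⟦a⟧^1 = ⦇a⦈^∂` is the extent of `a` and
`⟦a⟧^∂ = ⦇a⦈^1` is its intent. -/
def LEFrame.complexAlgebra {L : LESignature.{v}} (F : LEFrame.{u, v} L) :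
    LEAlgebra L F.Cpx where
  opF f a :=
    { extent := lowerPolar F.N (rel0 (F.RF f) fun i => side (a i) (L.epsF f i))
      intent := rel0 (F.RF f) fun i => side (a i) (L.epsF f i)
      upperPolar_extent := rel0_stable_dual (F.RF_stable_zero f) _
      lowerPolar_intent := rfl }
  opG g a :=
    { extent := rel0 (F.RG g) fun i => side (a i) (L.epsG g i).op
      intent := upperPolar F.N (rel0 (F.RG g) fun i => side (a i) (L.epsG g i).op)
      upperPolar_extent := rfl
      lowerPolar_intent := rel0_stable_one (F.RG_stable_zero g) _ }
  opF_join f a i x y := Concept.ext' (rel0_join (F.RF_stable f) a i x y)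
  opF_bot f a i := Concept.ext' (rel0_bot (F.RF_stable f) a i)
  opG_meet g a i x y := Concept.ext (by
    simp only [meetAt_eq]
    exact rel0_join (F.RG_stable g) a i x y)
  opG_top g a i := Concept.ext (by
    simp only [topAt_eq]
    exact rel0_bot (F.RG_stable g) a i)

/-! ### Filter-ideal frames -/

/-- Membership in a filter (`e = 1`) or in an ideal (`e = ∂`). -/
def memAt {A : Type u} [Lattice A] :
    (e : OSign) → Coord (Order.PFilter A) (Order.Ideal A) e → A → Prop
  | .one, H, a => a ∈ H
  | .dual, K, a => a ∈ K

/-- The relation `N⋆`: a filter and an ideal have a common element. -/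
def meets {A : Type u} [Lattice A] (H : Order.PFilter A) (K : Order.Ideal A) : Prop :=
  ∃ a, a ∈ H ∧ a ∈ K

/-- `P` is a filter of `A^e`. -/
structure IsFilterAt {A : Type u} [Lattice A] [BoundedOrder A] (e : OSign) (P : Set A) : Prop where
  top : topAt e ∈ P
  meet : ∀ x y, x ∈ P → y ∈ P → meetAt e x y ∈ P
  up : ∀ x y, leAt e x y → x ∈ P → y ∈ P

section FilterIdeal

variable {A : Type u} [Lattice A]

theorem isFilterAt_mem [BoundedOrder A] (e : OSign) (H : Coord (Order.PFilter A) (Order.Ideal A) e) :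
    IsFilterAt e {a | memAt e H a} := by
  cases e with
  | one => exact ⟨Order.PFilter.top_mem, fun _ _ hx hy => Order.PFilter.inf_mem hx hy,
      fun _ _ h hx => Order.PFilter.mem_of_le h hx⟩
  | dual => exact ⟨Order.Ideal.bot_mem _, fun _ _ hx hy => Order.Ideal.sup_mem hx hy,
      fun _ _ h hx => Order.Ideal.lower _ h hx⟩

theorem stable_of_filter [BoundedOrder A] (e : OSign) (P : Set A) (hP : IsFilterAt e.op P) :
    Stable meets e {H : Coord (Order.PFilter A) (Order.Ideal A) e | ∃ a ∈ P, memAt e H a} := by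
  cases e with
  | one =>
    refine subset_antisymm (fun H hH => ?_) (subset_lowerPolar_upperPolar _ _)
    let K : Order.Ideal A :=
      { carrier := P
        lower' := fun x y h hx => hP.up x y h hx
        nonempty' := ⟨_, hP.top⟩
        directed' := fun x hx y hy => ⟨x ⊔ y, hP.meet x y hx hy, le_sup_left, le_sup_right⟩ }
    obtain ⟨a, ha, hK⟩ := hH (b := K) (fun H' ⟨a, ha, h⟩ => ⟨a, h, ha⟩)
    exact ⟨a, hK, ha⟩
  | dual =>
    refine subset_antisymm (fun K hK => ?_) (subset_upperPolar_lowerPolar _ _)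
    let H : Order.PFilter A := Order.IsPFilter.toPFilter (F := P)
      (Order.IsPFilter.of_def ⟨_, hP.top⟩
        (fun x hx y hy => ⟨x ⊓ y, hP.meet x y hx hy, inf_le_left, inf_le_right⟩)
        (fun {x y} h hx => hP.up x y h hx))
    obtain ⟨a, ha, hK⟩ := hK (a := H) (fun K' ⟨a, ha, h⟩ => ⟨a, ha, h⟩)
    exact ⟨a, ha, hK⟩

theorem op_op (e : OSign) : e.op.op = e := by
  cases e <;> rfl

theorem leAt_refl (e : OSign) (x : A) : leAt e x x := by
  cases e <;> exact le_refl (α := A) x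

theorem leAt_trans (e : OSign) {x y z : A} (h : leAt e x y) (h' : leAt e y z) : leAt e x z := by
  cases e
  · exact le_trans (α := A) h h'
  · exact le_trans (α := A) h' h

theorem leAt_iff_join (e : OSign) {x y : A} : leAt e x y ↔ joinAt e x y = y := by
  cases e
  · exact sup_eq_right.symm
  · exact inf_eq_right.symm

theorem le_meetAt (e : OSign) {x y z : A} (h : leAt e x y) (h' : leAt e x z) :
    leAt e x (meetAt e y z) := by
  cases e
  · exact le_inf (α := A) h h'
  · exact sup_le (α := A) h h'

theorem meetAt_le_left (e : OSign) (x y : A) : leAt e (meetAt e x y) x := by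
  cases e
  · exact inf_le_left (α := A)
  · exact le_sup_left (α := A)

theorem meetAt_le_right (e : OSign) (x y : A) : leAt e (meetAt e x y) y := by
  cases e
  · exact inf_le_right (α := A)
  · exact le_sup_right (α := A)

theorem leAt_top [BoundedOrder A] (e : OSign) (x : A) : leAt e x (topAt e) := by
  cases e
  · exact le_top (α := A)
  · exact bot_le (α := A)

theorem leAt_op (e : OSign) (x y : A) : leAt e.op x y ↔ leAt e y x := by
  cases e <;> rfl

/-- The relation of a filter-ideal frame given by an operation `h`. -/
def starRel {n : ℕ} (e : Fin n → OSign) (s : OSign) (h : (Fin n → A) → A)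
    (K : Coord (Order.PFilter A) (Order.Ideal A) s)
    (H : ∀ i, Coord (Order.PFilter A) (Order.Ideal A) (e i)) : Prop :=
  ∃ a : Fin n → A, (∀ i, memAt (e i) (H i) (a i)) ∧ memAt s K (h a)

theorem mono_of_join {n : ℕ} {e : Fin n → OSign} {o : OSign} {h : (Fin n → A) → A}
    (hj : ∀ a i x y, h (Function.update a i (joinAt (e i) x y)) =
      joinAt o (h (Function.update a i x)) (h (Function.update a i y)))
    {a b : Fin n → A} (hab : ∀ i, leAt (e i) (a i) (b i)) : leAt o (h a) (h b) := by
  have key : ∀ s : Finset (Fin n), leAt o (h a) (h (s.piecewise b a)) := by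
    intro s
    induction s using Finset.induction_on with
    | empty => simpa using leAt_refl o (h a)
    | insert i s hi ih =>
      refine leAt_trans o ih ?_
      rw [Finset.piecewise_insert]
      have h1 := hj (s.piecewise b a) i (a i) (b i)
      rw [(leAt_iff_join _).1 (hab i)] at h1
      have h2 : Function.update (s.piecewise b a) i (a i) = s.piecewise b a := by
        conv_rhs => rw [← Function.update_eq_self i (s.piecewise b a)]
        rw [Finset.piecewise_eq_of_notMem _ _ _ hi]
      rw [h2] at h1
      exact (leAt_iff_join o).2 h1.symm
  simpa using key Finset.univ

theorem starRel_stable_zero [BoundedOrder A] {n : ℕ} {e : Fin n → OSign} {o s : OSign} (hs : s.op = o)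
    {h : (Fin n → A) → A}
    (hj : ∀ a i x y, h (Function.update a i (joinAt (e i) x y)) =
      joinAt o (h (Function.update a i x)) (h (Function.update a i y)))
    (H : ∀ i, Coord (Order.PFilter A) (Order.Ideal A) (e i)) :
    Stable meets s {K | starRel e s h K H} := by
  have hP : IsFilterAt s.op {b | ∃ a : Fin n → A, (∀ i, memAt (e i) (H i) (a i)) ∧
      leAt o (h a) b} := by
    rw [hs]
    refine ⟨⟨fun i => topAt (e i), fun i => (isFilterAt_mem _ (H i)).top, leAt_top _ _⟩, ?_, ?_⟩
    · rintro x y ⟨a, ha, hx⟩ ⟨b, hb, hy⟩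
      refine ⟨fun i => meetAt (e i) (a i) (b i),
        fun i => (isFilterAt_mem _ (H i)).meet _ _ (ha i) (hb i), le_meetAt o ?_ ?_⟩
      · exact leAt_trans o (mono_of_join hj fun i => meetAt_le_left _ _ _) hx
      · exact leAt_trans o (mono_of_join hj fun i => meetAt_le_right _ _ _) hy
    · rintro x y hxy ⟨a, ha, hx⟩
      exact ⟨a, ha, leAt_trans o hx hxy⟩
  convert stable_of_filter s _ hP using 1
  ext K
  constructor
  · rintro ⟨a, ha, hK⟩
    exact ⟨h a, ⟨a, ha, leAt_refl _ _⟩, hK⟩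
  · rintro ⟨b, ⟨a, ha, hb⟩, hK⟩
    refine ⟨a, ha, (isFilterAt_mem s K).up _ _ ?_ hK⟩
    rw [← hs, leAt_op] at hb
    exact hb

theorem starRel_stable [BoundedOrder A] {n : ℕ} {e : Fin n → OSign} {o s : OSign} (hs : s.op = o)
    {h : (Fin n → A) → A}
    (hj : ∀ a i x y, h (Function.update a i (joinAt (e i) x y)) =
      joinAt o (h (Function.update a i x)) (h (Function.update a i y)))
    (hb : ∀ a i, h (Function.update a i (botAt (e i))) = botAt o)
    (K : Coord (Order.PFilter A) (Order.Ideal A) s)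
    (H : ∀ i, Coord (Order.PFilter A) (Order.Ideal A) (e i)) (i : Fin n) :
    Stable meets (e i) {y | starRel e s h K (Function.update H i y)} := by
  have hos : s = o.op := by rw [← hs, op_op]
  have hP : IsFilterAt (e i).op {b | ∃ a : Fin n → A,
      (∀ j, j ≠ i → memAt (e j) (H j) (a j)) ∧ memAt s K (h (Function.update a i b))} := by
    refine ⟨⟨fun j => topAt (e j), fun j _ => (isFilterAt_mem _ (H j)).top, ?_⟩, ?_, ?_⟩
    · rw [topAt_eq, op_op, hb]
      have := (isFilterAt_mem s K).top
      rw [topAt_eq, hs] at this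
      exact this
    · rintro x y ⟨a, ha, hx⟩ ⟨b, hb', hy⟩
      refine ⟨fun j => meetAt (e j) (a j) (b j),
        fun j hji => (isFilterAt_mem _ (H j)).meet _ _ (ha j hji) (hb' j hji), ?_⟩
      rw [meetAt_eq, op_op, hj, ← hs, ← meetAt_eq]
      refine (isFilterAt_mem s K).meet _ _ ?_ ?_
      · refine (isFilterAt_mem s K).up _ _ ?_ hx
        rw [hos, leAt_op]
        refine mono_of_join hj fun j => ?_
        by_cases hji : j = i
        · subst hji; simpa using leAt_refl _ _
        · simpa [hji] using meetAt_le_left _ _ _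
      · refine (isFilterAt_mem s K).up _ _ ?_ hy
        rw [hos, leAt_op]
        refine mono_of_join hj fun j => ?_
        by_cases hji : j = i
        · subst hji; simpa using leAt_refl _ _
        · simpa [hji] using meetAt_le_right _ _ _
    · rintro x y hxy ⟨a, ha, hx⟩
      refine ⟨a, ha, (isFilterAt_mem s K).up _ _ ?_ hx⟩
      rw [leAt_op] at hxy
      rw [hos, leAt_op]
      refine mono_of_join hj fun j => ?_
      by_cases hji : j = i
      · subst hji; simpa using hxy
      · simpa [hji] using leAt_refl _ _
  convert stable_of_filter (e i) _ hP using 1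
  ext y
  constructor
  · rintro ⟨a, ha, hK⟩
    refine ⟨a i, ⟨a, fun j hji => by simpa [hji] using ha j, by simpa using hK⟩,
      by simpa using ha i⟩
  · rintro ⟨b, ⟨a, ha, hK⟩, hy⟩
    refine ⟨Function.update a i b, fun j => ?_, hK⟩
    by_cases hji : j = i
    · subst hji; simpa using hy
    · simpa [hji] using ha j hji

end FilterIdeal

/-- The filter-ideal frame of an `L`-algebra. Filters and ideals are nonempty, and need not be
proper. `R⋆_f(I, F̄)` holds iff `f(ā) ∈ I` for some `ā ∈ F̄`, and `R⋆_g(F, Ī)` holds iff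
`g(ā) ∈ F` for some `ā ∈ Ī`. -/
def LEAlgebra.filterIdealFrame {L : LESignature.{v}} {A : Type u} [Lattice A] [BoundedOrder A]
    (𝔸 : LEAlgebra L A) : LEFrame.{u, v} L where
  W := Order.PFilter A
  U := Order.Ideal A
  N := meets
  RF f := starRel (L.epsF f) .dual (𝔸.opF f)
  RG g := starRel (fun i => (L.epsG g i).op) .one (𝔸.opG g)
  RF_stable_zero f := starRel_stable_zero (o := .one) rfl (𝔸.opF_join f)
  RF_stable f := starRel_stable (s := .dual) (o := .one) rfl (𝔸.opF_join f) (𝔸.opF_bot f)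
  RG_stable_zero g := starRel_stable_zero (o := .dual) rfl
    (fun a i x y => by rw [← meetAt_eq]; exact 𝔸.opG_meet g a i x y)
  RG_stable g := starRel_stable (s := .one) (o := .dual) (h := 𝔸.opG g) rfl
    (fun a i x y => by rw [← meetAt_eq]; exact 𝔸.opG_meet g a i x y)
    (fun a i => by rw [← topAt_eq]; exact 𝔸.opG_top g a i)

/-- The filter-ideal extension of a frame: the filter-ideal frame of its complex algebra. -/
abbrev LEFrame.filterIdealExtension {L : LESignature.{v}} (F : LEFrame.{u, v} L) :
    LEFrame.{u, v} L :=
  F.complexAlgebra.filterIdealFrame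

/-! ### Ultrapowers -/

section Ultrapower

variable {W U J : Type u} (𝒰 : Ultrafilter J)

/-- The class of a `J`-sequence of elements of `W` (`e = 1`) or of `U` (`e = ∂`) in the
ultrapower. -/
def germAt : (e : OSign) → (J → Coord W U e) →
    Coord (Filter.Germ (𝒰 : Filter J) W) (Filter.Germ (𝒰 : Filter J) U) e
  | .one, s => (s : Filter.Germ (𝒰 : Filter J) W)
  | .dual, t => (t : Filter.Germ (𝒰 : Filter J) U)

theorem germAt_surj (e : OSign)
    (x : Coord (Filter.Germ (𝒰 : Filter J) W) (Filter.Germ (𝒰 : Filter J) U) e) :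
    ∃ s, germAt 𝒰 e s = x := by
  cases e with
  | one => exact Filter.Germ.inductionOn (p := fun x => ∃ s : J → W, ↑s = x) x fun s => ⟨s, rfl⟩
  | dual => exact Filter.Germ.inductionOn (p := fun x => ∃ s : J → U, ↑s = x) x fun s => ⟨s, rfl⟩

theorem germAt_eq (e : OSign) (s t : J → Coord W U e) :
    germAt 𝒰 e s = germAt 𝒰 e t ↔ {j | s j = t j} ∈ 𝒰 := by
  cases e with
  | one => exact Filter.Germ.coe_eq
  | dual => exact Filter.Germ.coe_eq

/-- The relation between `[x]` and `([y₁], …, [yₙ])` in the ultrapower: `R (x j) (y₁ j, …, yₙ j)`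
holds for `𝒰`-many `j`. By `ultraRel_germAt` it does not depend on the representatives. -/
def ultraRel {n : ℕ} (s : OSign) (e : Fin n → OSign)
    (R : Coord W U s → (∀ i, Coord W U (e i)) → Prop)
    (x : Coord (Filter.Germ (𝒰 : Filter J) W) (Filter.Germ (𝒰 : Filter J) U) s)
    (y : ∀ i, Coord (Filter.Germ (𝒰 : Filter J) W) (Filter.Germ (𝒰 : Filter J) U) (e i)) :
    Prop :=
  ∃ (x' : J → Coord W U s) (y' : ∀ i, J → Coord W U (e i)),
    germAt 𝒰 s x' = x ∧ (∀ i, germAt 𝒰 (e i) (y' i) = y i) ∧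
      {j | R (x' j) (fun i => y' i j)} ∈ 𝒰

theorem ultraRel_germAt {n : ℕ} (s : OSign) (e : Fin n → OSign)
    (R : Coord W U s → (∀ i, Coord W U (e i)) → Prop)
    (x : J → Coord W U s) (y : ∀ i, J → Coord W U (e i)) :
    ultraRel 𝒰 s e R (germAt 𝒰 s x) (fun i => germAt 𝒰 (e i) (y i)) ↔
      {j | R (x j) (fun i => y i j)} ∈ 𝒰 := by
  constructor
  · rintro ⟨x', y', hx, hy, h⟩
    have hx := (germAt_eq 𝒰 s x' x).1 hx
    have hy : ∀ᶠ j in (𝒰 : Filter J), ∀ i, y' i j = y i j :=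
      Filter.eventually_all.2 fun i => (germAt_eq 𝒰 (e i) (y' i) (y i)).1 (hy i)
    have : ∀ᶠ j in (𝒰 : Filter J), R (x j) (fun i => y i j) := by
      filter_upwards [hx, hy, h] with j h1 h2 h3
      have h2' : (fun i => y' i j) = fun i => y i j := funext h2
      have h1' : x' j = x j := h1
      have h3' : R (x' j) (fun i => y' i j) := h3
      rwa [h1', h2'] at h3'
    exact this
  · exact fun h => ⟨x, y, rfl, fun _ => rfl, h⟩

/-- The relation `N` of the ultrapower. -/
def ultraN (N : W → U → Prop) :
    Filter.Germ (𝒰 : Filter J) W → Filter.Germ (𝒰 : Filter J) U → Prop :=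
  Filter.Germ.LiftRel N

theorem stable_ultra (N : W → U → Prop) (e : OSign) (X : J → Set (Coord W U e))
    (hX : ∀ j, Stable N e (X j))
    (Z : Set (Coord (Filter.Germ (𝒰 : Filter J) W) (Filter.Germ (𝒰 : Filter J) U) e))
    (hZ : ∀ s, germAt 𝒰 e s ∈ Z ↔ {j | s j ∈ X j} ∈ 𝒰) :
    Stable (ultraN 𝒰 N) e Z := by
  classical
  cases e with
  | one =>
    refine subset_antisymm (fun z hz => ?_) (subset_lowerPolar_upperPolar _ _)
    obtain ⟨s, rfl⟩ := germAt_surj (W := W) (U := U) 𝒰 .one z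
    rw [hZ]
    by_contra hs
    have hs := Ultrafilter.compl_mem_iff_notMem.2 hs
    have hX' : ∀ j, j ∈ {j | s j ∈ X j}ᶜ → ∃ t : U, t ∈ upperPolar N (X j) ∧ ¬ N (s j) t := by
      intro j hj
      have h : lowerPolar N (upperPolar N (X j)) = X j := hX j
      have hj : s j ∉ X j := hj
      rw [← h] at hj
      simpa [lowerPolar] using hj
    obtain ⟨j0, hj0⟩ := 𝒰.nonempty_of_mem hs
    let t : J → U := fun j =>
      if hj : j ∈ {j | s j ∈ X j}ᶜ then (hX' j hj).choose else (hX' j0 hj0).choose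
    have ht : ∀ j, j ∈ {j | s j ∈ X j}ᶜ → t j ∈ upperPolar N (X j) ∧ ¬ N (s j) (t j) := by
      intro j hj
      simp only [t, dif_pos hj]
      exact (hX' j hj).choose_spec
    have hN : ∀ᶠ j in (𝒰 : Filter J), N (s j) (t j) := by
      refine hz (b := (t : Filter.Germ (𝒰 : Filter J) U)) fun z' hz' => ?_
      obtain ⟨s', rfl⟩ := germAt_surj (W := W) (U := U) 𝒰 .one z'
      rw [hZ] at hz'
      change ∀ᶠ j in (𝒰 : Filter J), N (s' j) (t j)
      filter_upwards [hz', hs] with j h1 h2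
      exact (ht j h2).1 h1
    obtain ⟨j, h1, h2⟩ := (hN.and hs).exists
    exact (ht j h2).2 h1
  | dual =>
    refine subset_antisymm (fun z hz => ?_) (subset_upperPolar_lowerPolar _ _)
    obtain ⟨s, rfl⟩ := germAt_surj (W := W) (U := U) 𝒰 .dual z
    rw [hZ]
    by_contra hs
    have hs := Ultrafilter.compl_mem_iff_notMem.2 hs
    have hX' : ∀ j, j ∈ {j | s j ∈ X j}ᶜ → ∃ t : W, t ∈ lowerPolar N (X j) ∧ ¬ N t (s j) := by
      intro j hj
      have h : upperPolar N (lowerPolar N (X j)) = X j := hX j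
      have hj : s j ∉ X j := hj
      rw [← h] at hj
      simpa [upperPolar] using hj
    obtain ⟨j0, hj0⟩ := 𝒰.nonempty_of_mem hs
    let t : J → W := fun j =>
      if hj : j ∈ {j | s j ∈ X j}ᶜ then (hX' j hj).choose else (hX' j0 hj0).choose
    have ht : ∀ j, j ∈ {j | s j ∈ X j}ᶜ → t j ∈ lowerPolar N (X j) ∧ ¬ N (t j) (s j) := by
      intro j hj
      simp only [t, dif_pos hj]
      exact (hX' j hj).choose_spec
    have hN : ∀ᶠ j in (𝒰 : Filter J), N (t j) (s j) := by
      refine hz (a := (t : Filter.Germ (𝒰 : Filter J) W)) fun z' hz' => ?_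
      obtain ⟨s', rfl⟩ := germAt_surj (W := W) (U := U) 𝒰 .dual z'
      rw [hZ] at hz'
      change ∀ᶠ j in (𝒰 : Filter J), N (t j) (s' j)
      filter_upwards [hz', hs] with j h1 h2
      exact (ht j h2).1 h1
    obtain ⟨j, h1, h2⟩ := (hN.and hs).exists
    exact (ht j h2).2 h1

theorem ultraRel_stable_zero (N : W → U → Prop) {n : ℕ} (s : OSign) (e : Fin n → OSign)
    (R : Coord W U s → (∀ i, Coord W U (e i)) → Prop)
    (hR : ∀ b, Stable N s {x | R x b})
    (y : ∀ i, Coord (Filter.Germ (𝒰 : Filter J) W) (Filter.Germ (𝒰 : Filter J) U) (e i)) :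
    Stable (ultraN 𝒰 N) s {x | ultraRel 𝒰 s e R x y} := by
  choose y' hy' using fun i => germAt_surj 𝒰 (e i) (y i)
  obtain rfl : (fun i => germAt 𝒰 (e i) (y' i)) = y := funext hy'
  exact stable_ultra 𝒰 N s (fun j => {x | R x (fun i => y' i j)}) (fun j => hR _) _
    fun x => ultraRel_germAt 𝒰 s e R x y'

theorem ultraRel_stable (N : W → U → Prop) {n : ℕ} (s : OSign) (e : Fin n → OSign)
    (R : Coord W U s → (∀ i, Coord W U (e i)) → Prop)
    (hR : ∀ x b i, Stable N (e i) {y | R x (Function.update b i y)})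
    (x : Coord (Filter.Germ (𝒰 : Filter J) W) (Filter.Germ (𝒰 : Filter J) U) s)
    (y : ∀ i, Coord (Filter.Germ (𝒰 : Filter J) W) (Filter.Germ (𝒰 : Filter J) U) (e i))
    (i : Fin n) :
    Stable (ultraN 𝒰 N) (e i) {z | ultraRel 𝒰 s e R x (Function.update y i z)} := by
  obtain ⟨x', rfl⟩ := germAt_surj 𝒰 s x
  choose y' hy' using fun i => germAt_surj 𝒰 (e i) (y i)
  obtain rfl : (fun i => germAt 𝒰 (e i) (y' i)) = y := funext hy'
  refine stable_ultra 𝒰 N (e i)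
    (fun j => {z | R (x' j) (Function.update (fun i => y' i j) i z)}) (fun j => hR _ _ _) _
    fun z => ?_
  have h1 : Function.update (fun i => germAt 𝒰 (e i) (y' i)) i (germAt 𝒰 (e i) z) =
      fun k => germAt 𝒰 (e k) (Function.update y' i z k) := by
    funext k
    by_cases hk : k = i
    · subst hk; simp
    · simp [hk]
  have h2 : ∀ j, Function.update (fun i => y' i j) i (z j) =
      fun k => Function.update y' i z k j := by
    intro j
    funext k
    by_cases hk : k = i
    · subst hk; simp
    · simp [hk]
  simp only [Set.mem_ofPred_eq, h1, h2]
  exact ultraRel_germAt 𝒰 s e R x' _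

end Ultrapower

/-- The ultrapower `F^J/𝒰` of a frame. -/
def LEFrame.ultrapower {L : LESignature.{v}} (F : LEFrame.{u, v} L) {J : Type u}
    (𝒰 : Ultrafilter J) : LEFrame.{u, v} L where
  W := Filter.Germ (𝒰 : Filter J) F.W
  U := Filter.Germ (𝒰 : Filter J) F.U
  N := ultraN 𝒰 F.N
  RF f := ultraRel 𝒰 .dual (L.epsF f) (F.RF f)
  RG g := ultraRel 𝒰 .one (fun i => (L.epsG g i).op) (F.RG g)
  RF_stable_zero f := ultraRel_stable_zero 𝒰 F.N .dual _ (F.RF f) (F.RF_stable_zero f)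
  RF_stable f := ultraRel_stable 𝒰 F.N .dual _ (F.RF f) (F.RF_stable f)
  RG_stable_zero g := ultraRel_stable_zero 𝒰 F.N .one _ (F.RG g) (F.RG_stable_zero g)
  RG_stable g := ultraRel_stable 𝒰 F.N .one _ (F.RG g) (F.RG_stable g)

/-! ### p-morphisms -/

/-- For a pair `S ⊆ W₁ × U₂`, `T ⊆ U₁ × W₂`: the set `(T⁽⁰⁾[w])^↓ ⊆ W₁` for a point `w` of `W₂`
(`e = 1`), and the set `(S⁽⁰⁾[u])^↑ ⊆ U₁` for a point `u` of `U₂` (`e = ∂`). -/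
def pull {L : LESignature.{v}} {F₁ F₂ : LEFrame.{u, v} L}
    (S : F₁.W → F₂.U → Prop) (T : F₁.U → F₂.W → Prop) :
    (e : OSign) → Coord F₂.W F₂.U e → Set (Coord F₁.W F₁.U e)
  | .one, w => lowerPolar F₁.N {u | T u w}
  | .dual, u => upperPolar F₁.N {w | S w u}

/-- p-morphisms `(S, T) : F₁ → F₂` of `L`-frames. -/
structure IsPMorphism {L : LESignature.{v}} {F₁ F₂ : LEFrame.{u, v} L}
    (S : F₁.W → F₂.U → Prop) (T : F₁.U → F₂.W → Prop) : Prop where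
  S_stable_zero : ∀ u : F₂.U, Stable F₁.N .one {w : F₁.W | S w u}
  S_stable_one : ∀ w : F₁.W, Stable F₂.N .dual {u : F₂.U | S w u}
  T_stable_zero : ∀ w : F₂.W, Stable F₁.N .dual {u : F₁.U | T u w}
  T_stable_one : ∀ u : F₁.U, Stable F₂.N .one {w : F₂.W | T u w}
  forth : ∀ w : F₂.W, lowerPolar F₁.N {u | T u w} ⊆ lowerPolar S (upperPolar F₂.N {w})
  back : ∀ w : F₁.W, lowerPolar T (lowerPolar F₂.N {u | S w u}) ⊆ upperPolar F₁.N {w}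
  map_F : ∀ (f : L.F) (w : ∀ i, Coord F₂.W F₂.U (L.epsF f i)),
    lowerPolar T (lowerPolar F₂.N {u | F₂.RF f u w}) =
      rel0 (F₁.RF f) fun i => pull S T (L.epsF f i) (w i)
  map_G : ∀ (g : L.G) (u : ∀ i, Coord F₂.W F₂.U (L.epsG g i).op),
    lowerPolar S (upperPolar F₂.N {w | F₂.RG g w u}) =
      rel0 (F₁.RG g) fun i => pull S T (L.epsG g i).op (u i)

/-- Surjective p-morphisms `(S, T) : F₁ ↠ F₂`: distinct elements `a`, `b` of the complex algebra of
`F₂` have distinct images `S⁽⁰⁾[⦇a⦈] ≠ S⁽⁰⁾[⦇b⦈]`. Then `F₂` is a p-morphic image of `F₁`. -/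
structure IsSurjectivePMorphism {L : LESignature.{v}} {F₁ F₂ : LEFrame.{u, v} L}
    (S : F₁.W → F₂.U → Prop) (T : F₁.U → F₂.W → Prop) : Prop where
  isPMorphism : IsPMorphism S T
  surjective : ∀ a b : F₂.Cpx, a ≠ b → lowerPolar S a.intent ≠ lowerPolar S b.intent

end LELogic

open LELogic

/-! For a concept `c`, let its ultrapower extent (intent) consist of the classes of sequences lying
almost everywhere in the extent (intent) of `c`. A filter `H` of concepts cuts out an intersection
of such extents (`core`), an ideal a union (`reach`), and dually on intents; `S` and `T` are
membership in `reach`. Polarity turns `reach` into `core` for any ultrafilter, by the Łoś argument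
`mem_ultraSide_iff_forall_orient`.

The remaining facts about the ultrapower are compactness statements. If the ultrapower realizes
every finitely satisfiable set of internal conditions indexed by `ℕ × F.Cpx`, then `reach` is
Galois-stable (`stable_reach`), the relation of a connective `h` evaluated on cores is the union of
the sets of `h(a)` with `a` ranging over the given filters and ideals (`rel0_ultraRel_core`), and
the core of `H` lies in the reach of `K` exactly when `H` meets `K` (`core_subset_reach_iff_meets`).
The last fact gives surjectivity.

On the side of the filter-ideal extension no saturation is needed: the concepts containing a point
of the ultrapower form a filter or ideal, which is itself a point of the extension, and testing
against it gives the back condition and the other half of the equations for connectives.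

The ultrafilter comes from Kunen's method for good ultrafilters. A large independent family of
functions is consumed, finitely many functions at a time, while a transfinite recursion decides
every possible refinement problem; any ultrafilter above the resulting filter is saturating. -/

/-! ### Saturating ultrafilters -/

section Saturation

open Cardinal

/-- The members of `𝓕` with index outside `N` are independent modulo `D`: every finite set of
conditions `𝓕 i j = v i` with `i ∉ N` is met `D`-frequently. -/
def IndependentMod {ι J V : Type*} (𝓕 : ι → J → V) (D : Filter J) (N : Set ι) : Prop :=
  ∀ t : Finset ι, Disjoint (t : Set ι) N → ∀ v : ι → V, ∃ᶠ j in D, ∀ i ∈ t, 𝓕 i j = v i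

/-- Modulo `D`, either some value of `p` is negligible, or `p` has a multiplicative refinement
`s ↦ {j | s ⊆ g j ∧ j ∈ p (g j)}` with values in `D`. -/
def DecidesRefinement {J K : Type*} (p : Finset K → Set J) (D : Filter J) : Prop :=
  (∃ u, ∀ᶠ j in D, j ∉ p u) ∨
    ∃ g : J → Finset K, (∀ c, ∀ᶠ j in D, c ∈ g j) ∧ ∀ᶠ j in D, j ∈ p (g j)

theorem DecidesRefinement.mono {J K : Type*} {p : Finset K → Set J} {D D' : Filter J}
    (h : DecidesRefinement p D) (hD : D' ≤ D) : DecidesRefinement p D' := by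
  rcases h with ⟨u, hu⟩ | ⟨g, hg, hp⟩
  · exact .inl ⟨u, hu.filter_mono hD⟩
  · exact .inr ⟨g, fun c => (hg c).filter_mono hD, hp.filter_mono hD⟩

/-- If every `p u` is compatible with all remaining independence conditions, one unused function can
serve as the refinement `g`. Otherwise some `p u` is incompatible with finitely many conditions, and
imposing these makes it negligible. Either way only finitely many functions are spent. -/
theorem IndependentMod.exists_decidesRefinement {ι J K : Type*} {𝓕 : ι → J → Finset K}
    {D : Filter J} {N : Set ι} (h : IndependentMod 𝓕 D N) (hN : N ≠ Set.univ)
    (p : Finset K → Set J) :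
    ∃ (D' : Filter J) (s : Finset ι),
      D' ≤ D ∧ IndependentMod 𝓕 D' (N ∪ s) ∧ DecidesRefinement p D' := by
  classical
  by_cases hp : ∀ t : Finset ι, Disjoint (t : Set ι) N → ∀ (v : ι → Finset K) (u : Finset K),
      ∃ᶠ j in D, j ∈ p u ∧ ∀ i ∈ t, 𝓕 i j = v i
  · obtain ⟨i₀, hi₀⟩ := (Set.ne_univ_iff_exists_notMem N).1 hN
    let B : Finset K → Filter J := fun u => D ⊓ Filter.principal {j | u ⊆ 𝓕 i₀ j ∧ j ∈ p (𝓕 i₀ j)}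
    have hB : Directed (· ≥ ·) B := fun u u' => ⟨u ∪ u',
      inf_le_inf_left _ (Filter.principal_mono.2 fun j hj =>
        ⟨Finset.union_subset_left hj.1, hj.2⟩),
      inf_le_inf_left _ (Filter.principal_mono.2 fun j hj =>
        ⟨Finset.union_subset_right hj.1, hj.2⟩)⟩
    have hBu : ∀ u, ∀ᶠ j in ⨅ u, B u, u ⊆ 𝓕 i₀ j ∧ j ∈ p (𝓕 i₀ j) := fun u =>
      Filter.Eventually.filter_mono ((iInf_le B u).trans inf_le_right)
        (Filter.mem_principal_self _)
    refine ⟨⨅ u, B u, {i₀}, (iInf_le B ∅).trans inf_le_left, fun t ht v hv => ?_,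
      .inr ⟨𝓕 i₀, fun c => (hBu {c}).mono fun j hj => Finset.singleton_subset_iff.1 hj.1,
        (hBu ∅).mono fun j hj => hj.2⟩⟩
    rw [Set.disjoint_union_right] at ht
    have hit : i₀ ∉ t := by simpa using ht.2
    obtain ⟨u, hu⟩ := (Filter.mem_iInf_of_directed hB _).1 hv
    have hu' : ∀ᶠ j in D, j ∈ {j | u ⊆ 𝓕 i₀ j ∧ j ∈ p (𝓕 i₀ j)} → ¬ ∀ i ∈ t, 𝓕 i j = v i :=
      Filter.eventually_inf_principal.1 hu
    have hd : Disjoint ((insert i₀ t : Finset ι) : Set ι) N := by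
      rw [Finset.coe_insert, Set.disjoint_insert_left]
      exact ⟨hi₀, ht.1⟩
    -- Prescribing the value `u` for the spent function, at a point of `p u`, lands in the set just
    -- added to the filter.
    obtain ⟨j, ⟨hj, hjv⟩, hj'⟩ := ((hp _ hd (Function.update v i₀ u) u).and_eventually hu').exists
    have h0 : 𝓕 i₀ j = u := by simpa using hjv i₀ (Finset.mem_insert_self _ _)
    refine hj' ⟨h0.ge, by rwa [h0]⟩ fun i hi => ?_
    have := hjv i (Finset.mem_insert_of_mem hi)
    rwa [Function.update_of_ne (by rintro rfl; exact hit hi)] at this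
  · push Not at hp
    obtain ⟨t, ht, v, u, hu⟩ := hp
    refine ⟨D ⊓ Filter.principal {j | ∀ i ∈ t, 𝓕 i j = v i}, t, inf_le_left,
      fun t' ht' v' hv' => ?_, .inl ⟨u, ?_⟩⟩
    · rw [Set.disjoint_union_right] at ht'
      have hv' := Filter.eventually_inf_principal.1 hv'
      have hd : Disjoint ((t ∪ t' : Finset ι) : Set ι) N := by
        rw [Finset.coe_union, Set.disjoint_union_left]
        exact ⟨ht, ht'.1⟩
      obtain ⟨j, hj, hj'⟩ := ((h _ hd (t.piecewise v v')).and_eventually hv').exists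
      refine hj' (fun i hi => ?_) fun i hi => ?_
      · simpa [hi] using hj i (Finset.mem_union_left _ hi)
      · have hit : i ∉ t := fun h => Set.disjoint_left.1 ht'.2 hi h
        simpa [hit] using hj i (Finset.mem_union_right _ hi)
    · refine Filter.eventually_inf_principal.2 (hu.mono fun j hj hjv hjp => ?_)
      obtain ⟨i, hi, hne⟩ := hj hjp
      exact hne (hjv i hi)

/-- An independent family of `2 ^ #K` functions on a set of size `#K`. -/
theorem exists_independentMod (K : Type u) [Infinite K] :
    ∃ (J : Type u) (𝓕 : Set K → J → Finset K), #J = #K ∧ IndependentMod 𝓕 ⊤ ∅ := by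
  classical
  -- A point is a finite set `s` with a finite table indexed by finite sets; the function of `A`
  -- looks up the trace of `A` on `s` and reads the entry as its support. If `s` separates the
  -- finitely many sets in question, their entries can be prescribed independently.
  refine ⟨Finset K × (Finset K →₀ (K →₀ ℕ)),
    fun A j => (j.2 (j.1.filter (· ∈ A))).support, ?_, fun t _ v => ?_⟩
  · simp
  · rw [Filter.frequently_top]
    have hsep : ∀ A B : Set K, ∃ s : Finset K, A ≠ B →
        ∃ k ∈ s, ¬ (k ∈ A ↔ k ∈ B) := by
      intro A B
      by_cases hAB : A = B
      · exact ⟨∅, fun h => (h hAB).elim⟩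
      · rw [Set.ext_iff] at hAB
        push Not at hAB
        obtain ⟨k, hk⟩ := hAB
        exact ⟨{k}, fun _ => ⟨k, Finset.mem_singleton_self k, by tauto⟩⟩
    choose d hd using hsep
    let s : Finset K := t.biUnion fun A => t.biUnion fun B => d A B
    have hinj : ∀ A ∈ t, ∀ B ∈ t, s.filter (· ∈ A) = s.filter (· ∈ B) → A = B := by
      intro A hA B hB hAB
      by_contra hne
      obtain ⟨k, hk, hk'⟩ := hd A B hne
      have hks : k ∈ s := Finset.mem_biUnion.2 ⟨A, hA, Finset.mem_biUnion.2 ⟨B, hB, hk⟩⟩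
      have := Finset.ext_iff.1 hAB k
      simp only [Finset.mem_filter, hks, true_and] at this
      exact hk' this
    let w : Finset K → (K →₀ ℕ) := fun x =>
      if hx : ∃ A ∈ t, s.filter (· ∈ A) = x then Finsupp.indicator (v hx.choose) fun _ _ => 1 else 0
    refine ⟨(s, Finsupp.indicator (t.image fun A => s.filter (· ∈ A)) fun x _ => w x),
      fun A hA => ?_⟩
    have hx : ∃ B ∈ t, s.filter (· ∈ B) = s.filter (· ∈ A) := ⟨A, hA, rfl⟩
    have hch : hx.choose = A := hinj _ hx.choose_spec.1 _ hA hx.choose_spec.2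
    have hw : w (s.filter (· ∈ A)) = Finsupp.indicator (v A) fun _ _ => 1 := by
      simp only [w]
      rw [dif_pos hx, hch]
    have hind : Finsupp.indicator (t.image fun A => s.filter (· ∈ A)) (fun x _ => w x)
        (s.filter (· ∈ A)) = w (s.filter (· ∈ A)) :=
      Finsupp.indicator_of_mem (Finset.mem_image_of_mem (fun A => s.filter (· ∈ A)) hA) _
    ext k
    simp only [hind, hw]
    by_cases hk : k ∈ v A <;> simp [hk, Finsupp.indicator_apply]

/-- A filter on a set of size `#K` which decides the refinement of every family
`p : Finset K → Set J`, obtained by well-ordering these families. -/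
theorem exists_forall_decidesRefinement (K : Type u) [Infinite K] :
    ∃ (J : Type u) (D : Filter J), D.NeBot ∧
      ∀ p : Finset K → Set J, DecidesRefinement p D := by
  classical
  obtain ⟨J, 𝓕, hJ, h𝓕⟩ := exists_independentMod K
  -- Stages run through the initial ordinal of `2 ^ #K`: there are enough of them to list all
  -- families `p`, since `#J = #K`, yet fewer than `2 ^ #K` precede any given one.
  let I : Type u := (#(Set K)).ord.ToType
  have hI : #I = #(Set K) := by simp [I]
  have hKinf : ℵ₀ ≤ #K := aleph0_le_mk K
  have hp : #(Finset K → Set J) ≤ #I := by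
    rw [hI, mk_set, ← power_def, mk_set, hJ, mk_finset_of_infinite, ← power_mul, mul_eq_self hKinf]
  have hne : Nonempty (Finset K → Set J) := ⟨fun _ => ∅⟩
  obtain ⟨e, he⟩ : ∃ e : I → (Finset K → Set J), Function.Surjective e := by
    obtain ⟨emb⟩ := (Cardinal.le_def _ _).1 hp
    exact ⟨Function.invFun emb, Function.invFun_surjective emb.injective⟩
  -- The step is made total, doing nothing in the bad case, so that the recursion can be defined
  -- before independence is known.
  have hstep : ∀ (D : Filter J) (N : Set (Set K)) (p : Finset K → Set J),
      ∃ x : Filter J × Finset (Set K), x.1 ≤ D ∧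
        (IndependentMod 𝓕 D N → N ≠ Set.univ →
          IndependentMod 𝓕 x.1 (N ∪ x.2) ∧ DecidesRefinement p x.1) := by
    intro D N p
    by_cases h : IndependentMod 𝓕 D N ∧ N ≠ Set.univ
    · obtain ⟨D', s, h1, h2, h3⟩ := h.1.exists_decidesRefinement h.2 p
      exact ⟨(D', s), h1, fun _ _ => ⟨h2, h3⟩⟩
    · exact ⟨(D, ∅), le_rfl, fun h1 h2 => (h ⟨h1, h2⟩).elim⟩
  choose step hle hstep using hstep
  let inc : I → Filter J × Finset (Set K) :=
    (wellFounded_lt (α := I)).fix fun i ih =>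
      step (⨅ j : Set.Iio i, (ih j j.2).1) (⋃ j : Set.Iio i, ((ih j j.2).2 : Set (Set K))) (e i)
  let D : I → Filter J := fun i => ⨅ j : Set.Iio i, (inc j).1
  let N : I → Set (Set K) := fun i => ⋃ j : Set.Iio i, ((inc j).2 : Set (Set K))
  have hinc : ∀ i, inc i = step (D i) (N i) (e i) := fun i => WellFounded.fix_eq _ _ i
  have hdec : ∀ i j, i ≤ j → (inc j).1 ≤ (inc i).1 := by
    intro i j hij
    rcases hij.eq_or_lt with rfl | hij
    · exact le_rfl
    · rw [hinc j]
      exact (hle _ _ _).trans (iInf_le (fun k : Set.Iio j => (inc k).1) ⟨i, hij⟩)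
  -- Each earlier stage spends finitely many functions, so fewer than `2 ^ #K` are spent and one is
  -- still available.
  have hN : ∀ i, N i ≠ Set.univ := by
    intro i hi
    have hlt : #(Set.Iio i) < #(Set K) := (mk_Iio_lt i (by simp [I])).trans_eq hI
    have hset : ℵ₀ < #(Set K) := hKinf.trans_lt (by rw [mk_set]; exact cantor _)
    have h1 : #(N i) ≤ #(Set.Iio i) * ℵ₀ :=
      (mk_iUnion_le _).trans (mul_le_mul_right (ciSup_le' fun j =>
        ((Finset.finite_toSet _).lt_aleph0).le) _)
    have h2 : #(N i) < #(Set K) := h1.trans_lt (mul_lt_of_lt hset.le hlt hset)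
    rw [hi, mk_univ] at h2
    exact lt_irrefl _ h2
  have hdir : ∀ s : Set I, Directed (· ≥ ·) fun j : s => (inc j).1 := fun s j k =>
    (le_total j.1 k.1).elim (fun h => ⟨k, hdec _ _ h, le_rfl⟩) fun h => ⟨j, le_rfl, hdec _ _ h⟩
  have hind : ∀ i, IndependentMod 𝓕 (D i) (N i) := by
    intro i
    induction i using WellFoundedLT.induction with
    | _ i ih =>
    intro t ht v hv
    rcases isEmpty_or_nonempty (Set.Iio i) with hempty | hnonempty
    · have hD : D i = ⊤ := iInf_of_empty _
      rw [hD] at hv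
      exact h𝓕 t (Set.disjoint_empty _) v hv
    -- The earlier filters form a chain, so a failure of independence would already occur at one of
    -- them.
    · obtain ⟨j, hj⟩ := (Filter.mem_iInf_of_directed (hdir _) _).1 hv
      have hgood := (hstep (D j) (N j) (e j) (ih j j.2) (hN j)).1
      rw [← hinc] at hgood
      refine hgood t (ht.mono_right ?_) v hj
      refine Set.union_subset (Set.iUnion_subset fun k => ?_) ?_
      · exact Set.subset_iUnion (fun k : Set.Iio i => ((inc k).2 : Set (Set K)))
          ⟨k, lt_trans (Set.mem_Iio.1 k.2) (Set.mem_Iio.1 j.2)⟩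
      · exact Set.subset_iUnion (fun k : Set.Iio i => ((inc k).2 : Set (Set K))) j
  have hgood : ∀ i, IndependentMod 𝓕 (inc i).1 (N i ∪ (inc i).2) ∧
      DecidesRefinement (e i) (inc i).1 := by
    intro i
    rw [hinc]
    exact hstep _ _ _ (hind i) (hN i)
  refine ⟨J, ⨅ i, (inc i).1, ?_, fun p => ?_⟩
  · have : Nonempty I := ⟨(he fun _ => ∅).choose⟩
    refine Filter.iInf_neBot_of_directed' (fun j k =>
      (le_total j k).elim (fun h => ⟨k, hdec _ _ h, le_rfl⟩) fun h => ⟨j, le_rfl, hdec _ _ h⟩)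
      fun i => ⟨fun hbot => ?_⟩
    -- Independence for the empty set of conditions says that the filter is proper.
    have := (hgood i).1 ∅ (by simp) fun _ => ∅
    rw [hbot] at this
    exact this Filter.eventually_bot
  · obtain ⟨i, rfl⟩ := he p
    exact (hgood i).2.mono (iInf_le _ i)

/-- The ultraproduct by `𝒰` of any family realizes every finitely satisfiable set of `#K` internal
conditions. -/
def IsSaturating (K : Type u) {J : Type u} (𝒰 : Ultrafilter J) : Prop :=
  ∀ (X : Type u) (φ : K → J → X → Prop),
    (∀ s : Finset K, ∀ᶠ j in (𝒰 : Filter J), ∃ x, ∀ c ∈ s, φ c j x) →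
      ∃ x : J → X, ∀ c, ∀ᶠ j in (𝒰 : Filter J), φ c j (x j)

/-- Take `p s` to be the set of `j` at which the conditions in `s` have a common solution. Finite
satisfiability excludes a negligible `p s`, so there is a refinement `g`; a common solution of the
conditions in `g j` is chosen at each `j`, and each condition belongs to `g j` almost everywhere.
Decisions persist in finer filters, so any ultrafilter above `D` will do. -/
theorem exists_isSaturating (K : Type u) [Infinite K] :
    ∃ (J : Type u) (𝒰 : Ultrafilter J), IsSaturating K 𝒰 := by
  obtain ⟨J, D, hD, h⟩ := exists_forall_decidesRefinement K
  refine ⟨J, Ultrafilter.of D, fun X φ hφ => ?_⟩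
  have hX : Nonempty X := (hφ ∅).exists.elim fun _ ⟨x, _⟩ => ⟨x⟩
  rcases (h fun s => {j | ∃ x, ∀ c ∈ s, φ c j x}).mono (Ultrafilter.of_le D) with
    ⟨s, hs⟩ | ⟨g, hg, hgφ⟩
  · obtain ⟨j, hj, hj'⟩ := (hs.and (hφ s)).exists
    exact (hj hj').elim
  · have hx : ∀ j, ∃ x, (∃ x, ∀ c ∈ g j, φ c j x) → ∀ c ∈ g j, φ c j x := fun j => by
      by_cases hj : ∃ x, ∀ c ∈ g j, φ c j x
      · exact ⟨hj.choose, fun _ => hj.choose_spec⟩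
      · exact ⟨hX.some, fun h => (hj h).elim⟩
    choose x hx using hx
    refine ⟨x, fun c => ?_⟩
    filter_upwards [hg c, hgφ] with j h1 h2
    exact hx j h2 c h1

end Saturation

/-! ### Signed polarities -/

section Orient

variable {W U : Type u}

/-- The relation `N`, read from `W` to `U` for `e = 1` and from `U` to `W` for `e = ∂`. -/
def orient (N : W → U → Prop) : (e : OSign) → Coord W U e → Coord W U e.op → Prop
  | .one, w, u => N w u
  | .dual, u, w => N w u

theorem stable_of_forall_exists {N : W → U → Prop} {e : OSign} {Z : Set (Coord W U e)}
    (h : ∀ x ∉ Z, ∃ y, (∀ z ∈ Z, orient N e z y) ∧ ¬ orient N e x y) : Stable N e Z := by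
  cases e with
  | one =>
    refine subset_antisymm (fun x hx => ?_) (subset_lowerPolar_upperPolar _ _)
    by_contra hxZ
    obtain ⟨y, hy, hxy⟩ := h x hxZ
    exact hxy (hx fun z hz => hy z hz)
  | dual =>
    refine subset_antisymm (fun x hx => ?_) (subset_upperPolar_lowerPolar _ _)
    by_contra hxZ
    obtain ⟨y, hy, hxy⟩ := h x hxZ
    exact hxy (hx fun z hz => hy z hz)

variable {N : W → U → Prop}

theorem mem_side_iff_forall_orient {e : OSign} {c : Concept W U N} {x : Coord W U e} :
    x ∈ side c e ↔ ∀ y ∈ side c e.op, orient N e x y := by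
  cases e with
  | one => exact (Set.ext_iff.1 c.lowerPolar_intent x).symm
  | dual => exact (Set.ext_iff.1 c.upperPolar_extent x).symm

theorem side_mono {e : OSign} {c d : Concept W U N} (h : leAt e c d) : side c e ⊆ side d e := by
  cases e with
  | one => exact Concept.extent_subset_extent_iff.2 h
  | dual => exact Concept.intent_subset_intent_iff.2 h

theorem side_topAt (e : OSign) : side (topAt e : Concept W U N) e = Set.univ := by
  cases e with
  | one => exact Concept.extent_top
  | dual => exact Concept.intent_bot

theorem side_meetAt (e : OSign) (c d : Concept W U N) :
    side (meetAt e c d) e = side c e ∩ side d e := by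
  cases e with
  | one => exact Concept.extent_inf ..
  | dual => exact Concept.intent_sup ..

end Orient

/-! ### Filters of `A^e` and finite bounds inside them -/

section SignedFilter

variable {A : Type u} [Lattice A] [BoundedOrder A]

theorem LELogic.IsFilterAt.exists_forall_leAt {e : OSign} {P : Set A} (hP : IsFilterAt e P)
    (s : Finset A) (hs : ∀ a ∈ s, a ∈ P) : ∃ b ∈ P, ∀ a ∈ s, leAt e b a := by
  classical
  induction s using Finset.induction_on with
  | empty => exact ⟨_, hP.top, by simp⟩
  | insert a s _ ih =>
    obtain ⟨b, hb, hbs⟩ := ih fun a' ha' => hs a' (Finset.mem_insert_of_mem ha')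
    refine ⟨meetAt e a b, hP.meet _ _ (hs a (Finset.mem_insert_self a s)) hb, fun a' ha' => ?_⟩
    rcases Finset.mem_insert.1 ha' with rfl | ha'
    · exact meetAt_le_left e _ _
    · exact leAt_trans e (meetAt_le_right e _ _) (hbs a' ha')

theorem LELogic.IsFilterAt.exists_memAt_iff {e : OSign} {P : Set A} (hP : IsFilterAt e P) :
    ∃ H : Coord (Order.PFilter A) (Order.Ideal A) e, ∀ a, memAt e H a ↔ a ∈ P := by
  cases e with
  | one =>
    exact ⟨Order.IsPFilter.toPFilter (F := P)
      (Order.IsPFilter.of_def ⟨_, hP.top⟩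
        (fun x hx y hy => ⟨x ⊓ y, hP.meet x y hx hy, inf_le_left, inf_le_right⟩)
        (fun {x y} h hx => hP.up x y h hx)), fun _ => Iff.rfl⟩
  | dual =>
    exact ⟨{ carrier := P
             lower' := fun x y h hx => hP.up x y h hx
             nonempty' := ⟨_, hP.top⟩
             directed' := fun x hx y hy =>
              ⟨x ⊔ y, hP.meet x y hx hy, le_sup_left, le_sup_right⟩ }, fun _ => Iff.rfl⟩

/-- This verifies finite satisfiability in each saturation argument: the finitely many concepts
involved that lie in `H` are replaced by a single bound in `H`. -/
theorem exists_memAt_forall_leAt {e : OSign} (H : Coord (Order.PFilter A) (Order.Ideal A) e)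
    (s : Finset A) : ∃ b, memAt e H b ∧ ∀ a ∈ s, memAt e H a → leAt e b a := by
  classical
  obtain ⟨b, hb, hbs⟩ := (isFilterAt_mem e H).exists_forall_leAt (s.filter (memAt e H))
    fun a ha => (Finset.mem_filter.1 ha).2
  exact ⟨b, hb, fun a ha haH => hbs a (Finset.mem_filter.2 ⟨ha, haH⟩)⟩

end SignedFilter

/-! ### Points of the ultrapower and filters or ideals of concepts -/

section UltraSide

variable {W U J : Type u} {N : W → U → Prop} (𝒰 : Ultrafilter J)

/-- The classes of the sequences which are almost everywhere in the extent (`e = 1`) or in the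
intent (`e = ∂`) of `c`. -/
def ultraSide : (e : OSign) → Concept W U N →
    Set (Coord (Filter.Germ (𝒰 : Filter J) W) (Filter.Germ (𝒰 : Filter J) U) e)
  | .one, c => {x | Filter.Germ.LiftPred (· ∈ c.extent) x}
  | .dual, c => {x | Filter.Germ.LiftPred (· ∈ c.intent) x}

theorem germAt_mem_ultraSide {e : OSign} {c : Concept W U N} {s : J → Coord W U e} :
    germAt 𝒰 e s ∈ ultraSide 𝒰 e c ↔ ∀ᶠ j in (𝒰 : Filter J), s j ∈ side c e := by
  cases e <;> exact Iff.rfl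

theorem orient_germAt {e : OSign} {s : J → Coord W U e} {t : J → Coord W U e.op} :
    orient (ultraN 𝒰 N) e (germAt 𝒰 e s) (germAt 𝒰 e.op t) ↔
      ∀ᶠ j in (𝒰 : Filter J), orient N e (s j) (t j) := by
  cases e <;> exact Iff.rfl

/-- An instance of Łoś's theorem: if `x` is almost everywhere outside the given side of `c`,
choosing counterexamples on the other side coordinatewise gives one class that refutes the
right-hand condition. -/
theorem mem_ultraSide_iff_forall_orient {e : OSign} {c : Concept W U N}
    {x : Coord (Filter.Germ (𝒰 : Filter J) W) (Filter.Germ (𝒰 : Filter J) U) e} :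
    x ∈ ultraSide 𝒰 e c ↔ ∀ y ∈ ultraSide 𝒰 e.op c, orient (ultraN 𝒰 N) e x y := by
  obtain ⟨s, rfl⟩ := germAt_surj 𝒰 e x
  constructor
  · intro hs y hy
    obtain ⟨t, rfl⟩ := germAt_surj 𝒰 e.op y
    rw [germAt_mem_ultraSide] at hs hy
    rw [orient_germAt]
    filter_upwards [hs, hy] with j h1 h2
    exact mem_side_iff_forall_orient.1 h1 _ h2
  · intro h
    rw [germAt_mem_ultraSide]
    by_contra hs
    rw [← Ultrafilter.eventually_not] at hs
    have hs' : ∀ᶠ j in (𝒰 : Filter J), ∃ y ∈ side c e.op, ¬ orient N e (s j) y := by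
      filter_upwards [hs] with j hj
      rw [mem_side_iff_forall_orient] at hj
      push Not at hj
      exact hj
    obtain ⟨t, ht⟩ := hs'.choice
    have := h (germAt 𝒰 e.op t) ((germAt_mem_ultraSide 𝒰).2 (ht.mono fun j hj => hj.1))
    rw [orient_germAt] at this
    obtain ⟨j, h1, h2⟩ := (this.and ht).exists
    exact h2.2 h1

theorem isFilterAt_ultraSide (e : OSign)
    (x : Coord (Filter.Germ (𝒰 : Filter J) W) (Filter.Germ (𝒰 : Filter J) U) e) :
    IsFilterAt e {c : Concept W U N | x ∈ ultraSide 𝒰 e c} := by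
  obtain ⟨s, rfl⟩ := germAt_surj 𝒰 e x
  simp only [germAt_mem_ultraSide]
  refine ⟨?_, fun c d hc hd => ?_, fun c d hcd hc => ?_⟩
  · exact Filter.Eventually.of_forall fun j => by rw [side_topAt]; trivial
  · exact (Filter.Eventually.and hc hd).mono fun j hj => by rw [side_meetAt]; exact hj
  · exact Filter.Eventually.mono hc fun j hj => side_mono hcd hj

/-- The points which belong to some concept in an ideal (`e = 1`) or in a filter (`e = ∂`). -/
def reach (e : OSign)
    (K : Coord (Order.PFilter (Concept W U N)) (Order.Ideal (Concept W U N)) e.op) :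
    Set (Coord (Filter.Germ (𝒰 : Filter J) W) (Filter.Germ (𝒰 : Filter J) U) e) :=
  {x | ∃ c, memAt e.op K c ∧ x ∈ ultraSide 𝒰 e c}

/-- The points which belong to all concepts in a filter (`e = 1`) or in an ideal (`e = ∂`). -/
def core (e : OSign)
    (H : Coord (Order.PFilter (Concept W U N)) (Order.Ideal (Concept W U N)) e) :
    Set (Coord (Filter.Germ (𝒰 : Filter J) W) (Filter.Germ (𝒰 : Filter J) U) e) :=
  {x | ∀ c, memAt e H c → x ∈ ultraSide 𝒰 e c}

/-- The polar of a union is the intersection of the polars, so no saturation is involved. -/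
theorem lowerPolar_reach (H : Order.PFilter (Concept W U N)) :
    lowerPolar (ultraN 𝒰 N) (reach 𝒰 .dual H) = core 𝒰 .one H := by
  ext x
  refine ⟨fun h c hc => (mem_ultraSide_iff_forall_orient 𝒰).2 fun y hy => h ⟨c, hc, hy⟩, ?_⟩
  rintro h y ⟨c, hc, hy⟩
  exact (mem_ultraSide_iff_forall_orient 𝒰 (e := .one)).1 (h c hc) y hy

theorem upperPolar_reach (K : Order.Ideal (Concept W U N)) :
    upperPolar (ultraN 𝒰 N) (reach 𝒰 .one K) = core 𝒰 .dual K := by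
  ext x
  refine ⟨fun h c hc => (mem_ultraSide_iff_forall_orient 𝒰).2 fun y hy => h ⟨c, hc, hy⟩, ?_⟩
  rintro h y ⟨c, hc, hy⟩
  exact (mem_ultraSide_iff_forall_orient 𝒰 (e := .dual)).1 (h c hc) y hy

theorem stable_setOf_mem_reach_one (x : Filter.Germ (𝒰 : Filter J) W) :
    Stable meets .dual {K : Order.Ideal (Concept W U N) | x ∈ reach 𝒰 .one K} := by
  convert stable_of_filter .dual _ (isFilterAt_ultraSide (N := N) 𝒰 .one x) using 1
  ext K
  exact exists_congr fun c => and_comm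

theorem stable_setOf_mem_reach_dual (x : Filter.Germ (𝒰 : Filter J) U) :
    Stable meets .one {H : Order.PFilter (Concept W U N) | x ∈ reach 𝒰 .dual H} := by
  convert stable_of_filter .one _ (isFilterAt_ultraSide (N := N) 𝒰 .dual x) using 1
  ext K
  exact exists_congr fun c => and_comm

variable {𝒰}

/-- A point outside `reach` must be separated from it by one `y` lying on the opposite side of all
concepts in `K`. Finitely many of them are bounded by some `b` in `K`; since `x` is not in `b`, a
suitable `y` exists almost everywhere, and saturation makes it uniform. -/
theorem stable_reach (h𝒰 : IsSaturating (ℕ × Concept W U N) 𝒰)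
    (e : OSign)
    (K : Coord (Order.PFilter (Concept W U N)) (Order.Ideal (Concept W U N)) e.op) :
    Stable (ultraN 𝒰 N) e (reach 𝒰 e K) := by
  classical
  refine stable_of_forall_exists fun x hx => ?_
  obtain ⟨s, rfl⟩ := germAt_surj 𝒰 e x
  obtain ⟨t, ht⟩ := h𝒰 (Coord W U e.op)
    (fun c j y => (memAt e.op K c.2 → y ∈ side c.2 e.op) ∧ ¬ orient N e (s j) y) (fun r => by
      obtain ⟨b, hb, hbr⟩ := exists_memAt_forall_leAt K (r.image Prod.snd)
      have hs : ¬ ∀ᶠ j in (𝒰 : Filter J), s j ∈ side b e :=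
        fun h => hx ⟨b, hb, (germAt_mem_ultraSide 𝒰).2 h⟩
      rw [← Ultrafilter.eventually_not] at hs
      filter_upwards [hs] with j hj
      rw [mem_side_iff_forall_orient] at hj
      push Not at hj
      obtain ⟨y, hy, hjy⟩ := hj
      exact ⟨y, fun c hc => ⟨fun hcK =>
        side_mono (hbr _ (Finset.mem_image_of_mem _ hc) hcK) hy, hjy⟩⟩)
  refine ⟨germAt 𝒰 e.op t, ?_, fun h => ?_⟩
  · rintro z ⟨c, hc, hz⟩
    refine (mem_ultraSide_iff_forall_orient 𝒰).1 hz _ ((germAt_mem_ultraSide 𝒰).2 ?_)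
    exact (ht (0, c)).mono fun j hj => hj.1 hc
  · rw [orient_germAt] at h
    -- Every condition includes the failure of `N`, so any index serves.
    obtain ⟨j, h1, h2⟩ := (h.and (ht (0, ⊤))).exists
    exact h2.2 h1

/-- If `x` lies in no `h(a)`, then bounding finitely many concepts in each coordinate by some `a i`
yields a tuple in the sides of the `a i` at which `R` fails. Saturation produces a tuple in the
cores at which the ultrapower relation fails. -/
theorem rel0_ultraRel_core (h𝒰 : IsSaturating (ℕ × Concept W U N) 𝒰)
    {n : ℕ} {s : OSign} {e : Fin n → OSign}
    {R : Coord W U s → (∀ i, Coord W U (e i)) → Prop}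
    {h : (Fin n → Concept W U N) → Concept W U N}
    (hR : ∀ a, side (h a) s = rel0 R fun i => side (a i) (e i))
    (H : ∀ i, Coord (Order.PFilter (Concept W U N)) (Order.Ideal (Concept W U N)) (e i)) :
    rel0 (ultraRel 𝒰 s e R) (fun i => core 𝒰 (e i) (H i)) =
      {x | ∃ a : Fin n → Concept W U N,
        (∀ i, memAt (e i) (H i) (a i)) ∧ x ∈ ultraSide 𝒰 s (h a)} := by
  classical
  ext x
  obtain ⟨x, rfl⟩ := germAt_surj 𝒰 s x
  constructor
  · intro hx
    by_contra hxa
    obtain ⟨b, hb⟩ := h𝒰 (∀ i, Coord W U (e i))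
      -- The number in the index names the coordinate constrained. The failure of `R` is part of
      -- every condition, so it is imposed even when `n = 0`.
      (fun c j b => (∀ i : Fin n, i.val = c.1 → memAt (e i) (H i) c.2 → b i ∈ side c.2 (e i)) ∧
        ¬ R (x j) b) (fun r => by
        choose a haH har using fun i => exists_memAt_forall_leAt (H i) (r.image Prod.snd)
        have hs : ¬ ∀ᶠ j in (𝒰 : Filter J), x j ∈ side (h a) s :=
          fun h => hxa ⟨a, haH, (germAt_mem_ultraSide 𝒰).2 h⟩
        rw [← Ultrafilter.eventually_not] at hs
        filter_upwards [hs] with j hj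
        have hj' : ¬ ∀ b : ∀ i, Coord W U (e i), (∀ i, b i ∈ side (a i) (e i)) → R (x j) b := by
          rw [hR] at hj
          exact hj
        push Not at hj'
        obtain ⟨b, hb, hjb⟩ := hj'
        exact ⟨b, fun c hc => ⟨fun i _ hcH =>
          side_mono (har i _ (Finset.mem_image_of_mem _ hc) hcH) (hb i), hjb⟩⟩)
    have hxb := (ultraRel_germAt 𝒰 s e R x fun i j => b j i).1 (hx _ fun i c hc =>
      (germAt_mem_ultraSide 𝒰).2 ((hb (i, c)).mono fun j hj => hj.1 i rfl hc))
    obtain ⟨j, h1, h2⟩ := (Filter.Eventually.and hxb (hb (0, ⊤))).exists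
    exact h2.2 h1
  · rintro ⟨a, haH, hxa⟩ b hb
    choose b' hb' using fun i => germAt_surj 𝒰 (e i) (b i)
    obtain rfl : (fun i => germAt 𝒰 (e i) (b' i)) = b := funext hb'
    refine (ultraRel_germAt 𝒰 s e R x b').2 ?_
    rw [germAt_mem_ultraSide] at hxa
    have hba : ∀ᶠ j in (𝒰 : Filter J), ∀ i, b' i j ∈ side (a i) (e i) :=
      Filter.eventually_all.2 fun i => (germAt_mem_ultraSide 𝒰).1 (hb i (a i) (haH i))
    change ∀ᶠ j in (𝒰 : Filter J), R (x j) fun i => b' i j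
    filter_upwards [hxa, hba] with j h1 h2
    rw [hR] at h1
    exact h1 _ h2

/-- If `H` and `K` are disjoint, no `a` in `H` is below any `b` in `K`, so some point is in the
extent of `a` but not of `b`; saturation gives a point of the core outside the reach. -/
theorem core_subset_reach_iff_meets (h𝒰 : IsSaturating (ℕ × Concept W U N) 𝒰)
    {H : Order.PFilter (Concept W U N)} {K : Order.Ideal (Concept W U N)} :
    core 𝒰 .one H ⊆ reach 𝒰 .one K ↔ meets H K := by
  classical
  constructor
  · intro h
    by_contra hHK
    obtain ⟨t, ht⟩ := h𝒰 W
      -- Tag `0` marks the demands of `H` and tag `1` those of `K`.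
      (fun c _ w => (c.1 = 0 → c.2 ∈ H → w ∈ c.2.extent) ∧ (c.1 = 1 → c.2 ∈ K → w ∉ c.2.extent))
      (fun r => Filter.Eventually.of_forall fun _ => by
        obtain ⟨a, ha, har⟩ := exists_memAt_forall_leAt (e := .one) H (r.image Prod.snd)
        obtain ⟨b, hb, hbr⟩ := exists_memAt_forall_leAt (e := .dual) K (r.image Prod.snd)
        have hab : ¬ a.extent ⊆ b.extent := fun hab =>
          hHK ⟨a, ha, K.lower (Concept.extent_subset_extent_iff.1 hab) hb⟩
        obtain ⟨w, hwa, hwb⟩ := Set.not_subset.1 hab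
        refine ⟨w, fun c hc => ⟨fun _ hcH => ?_, fun _ hcK hw => ?_⟩⟩
        · exact side_mono (har _ (Finset.mem_image_of_mem _ hc) hcH) hwa
        · exact hwb (Concept.extent_subset_extent_iff.2
            (hbr _ (Finset.mem_image_of_mem _ hc) hcK) hw))
    obtain ⟨d, hd, htd⟩ := h (show germAt 𝒰 .one t ∈ core 𝒰 .one H from fun c hc =>
      (germAt_mem_ultraSide (e := .one) 𝒰).2 ((ht (0, c)).mono fun j hj => hj.1 rfl hc))
    obtain ⟨j, h1, h2⟩ := (Filter.Eventually.and
      ((germAt_mem_ultraSide (e := .one) 𝒰).1 htd) (ht (1, d))).exists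
    exact h2.2 rfl hd h1
  · rintro ⟨c, hcH, hcK⟩ x hx
    exact ⟨c, hcK, hx c hcH⟩

end UltraSide

/-! ### The p-morphism onto the filter-ideal extension -/

section PMorphism

variable {W U J : Type u} {N : W → U → Prop} (𝒰 : Ultrafilter J)

/-- The concepts whose ultrapower intent contains `x` form an ideal, which falls in the double polar
of the stable set and hence in the set itself; this yields `a`. Conversely, the principal ideal of
`h a` belongs to the stable set, so every filter in its polar contains `h a`. -/
theorem lowerPolar_reach_lowerPolar_starRel {n : ℕ} {e : Fin n → OSign}
    {h : (Fin n → Concept W U N) → Concept W U N}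
    {H : ∀ i, Coord (Order.PFilter (Concept W U N)) (Order.Ideal (Concept W U N)) (e i)}
    (hs : Stable meets .dual {K | starRel e .dual h K H}) :
    lowerPolar (fun t H' => t ∈ reach 𝒰 .dual H') (lowerPolar meets {K | starRel e .dual h K H}) =
      {x | ∃ a : Fin n → Concept W U N,
        (∀ i, memAt (e i) (H i) (a i)) ∧ x ∈ ultraSide 𝒰 .dual (h a)} := by
  ext x
  constructor
  · intro hx
    obtain ⟨K, hK⟩ := (isFilterAt_ultraSide (N := N) 𝒰 .dual x).exists_memAt_iff
    have hs : upperPolar meets (lowerPolar meets {K | starRel e .dual h K H}) =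
      {K | starRel e .dual h K H} := hs
    have hKs : K ∈ upperPolar meets (lowerPolar meets {K | starRel e .dual h K H}) := by
      intro H' hH'
      obtain ⟨c, hc, hxc⟩ := hx hH'
      exact ⟨c, hc, (hK c).2 hxc⟩
    rw [hs] at hKs
    obtain ⟨a, ha, haK⟩ := hKs
    exact ⟨a, ha, (hK _).1 haK⟩
  · rintro ⟨a, ha, hxa⟩ H' hH'
    obtain ⟨c, hcH, hc⟩ := hH' (b := Order.Ideal.principal (h a))
      ⟨a, ha, Order.Ideal.mem_principal.2 le_rfl⟩
    exact ⟨h a, Order.PFilter.mem_of_le (Order.Ideal.mem_principal.1 hc) hcH, hxa⟩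

theorem lowerPolar_reach_upperPolar_starRel {n : ℕ} {e : Fin n → OSign}
    {h : (Fin n → Concept W U N) → Concept W U N}
    {H : ∀ i, Coord (Order.PFilter (Concept W U N)) (Order.Ideal (Concept W U N)) (e i)}
    (hs : Stable meets .one {K | starRel e .one h K H}) :
    lowerPolar (fun w K' => w ∈ reach 𝒰 .one K') (upperPolar meets {K | starRel e .one h K H}) =
      {x | ∃ a : Fin n → Concept W U N,
        (∀ i, memAt (e i) (H i) (a i)) ∧ x ∈ ultraSide 𝒰 .one (h a)} := by
  ext x
  constructor
  · intro hx
    obtain ⟨K, hK⟩ := (isFilterAt_ultraSide (N := N) 𝒰 .one x).exists_memAt_iff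
    have hs : lowerPolar meets (upperPolar meets {K | starRel e .one h K H}) =
      {K | starRel e .one h K H} := hs
    have hKs : K ∈ lowerPolar meets (upperPolar meets {K | starRel e .one h K H}) := by
      intro H' hH'
      obtain ⟨c, hc, hxc⟩ := hx hH'
      exact ⟨c, (hK c).2 hxc, hc⟩
    rw [hs] at hKs
    obtain ⟨a, ha, haK⟩ := hKs
    exact ⟨a, ha, (hK _).1 haK⟩
  · rintro ⟨a, ha, hxa⟩ K' hK'
    obtain ⟨c, hc, hcK⟩ := hK' (a := Order.PFilter.principal (h a))
      ⟨a, ha, Order.PFilter.mem_principal.2 le_rfl⟩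
    exact ⟨h a, K'.lower (Order.PFilter.mem_principal.1 hc) hcK, hxa⟩

end PMorphism

theorem isSurjectivePMorphism_reach {L : LESignature.{v}} (F : LEFrame.{u, v} L) {J : Type u}
    {𝒰 : Ultrafilter J} (h𝒰 : IsSaturating (ℕ × F.Cpx) 𝒰) :
    IsSurjectivePMorphism (F₁ := F.ultrapower 𝒰) (F₂ := F.filterIdealExtension)
      (fun w K => w ∈ reach 𝒰 .one K) (fun t H => t ∈ reach 𝒰 .dual H) := by
  have hpull : ∀ e H, pull (F₁ := F.ultrapower 𝒰) (F₂ := F.filterIdealExtension)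
      (fun w K => w ∈ reach 𝒰 .one K) (fun t H => t ∈ reach 𝒰 .dual H) e H = core 𝒰 e H := by
    rintro (_ | _) H
    · exact lowerPolar_reach 𝒰 H
    · exact upperPolar_reach 𝒰 H
  refine ⟨⟨fun K => stable_reach h𝒰 .one K, stable_setOf_mem_reach_one 𝒰,
    fun H => stable_reach h𝒰 .dual H, stable_setOf_mem_reach_dual 𝒰, fun H x hx K hK => ?_,
    fun x t ht => ?_, fun f H => ?_, fun g K => ?_⟩, fun a b hab heq => hab ?_⟩
  · obtain ⟨c, hcH, hcK⟩ := (mem_upperPolar_singleton _).1 hK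
    exact ⟨c, hcK, (lowerPolar_reach 𝒰 H).subset hx c hcH⟩
  -- The hypothesis on `t` is tested on the filter of all concepts containing `x`.
  · obtain ⟨H, hH⟩ := (isFilterAt_ultraSide (N := F.N) 𝒰 .one x).exists_memAt_iff
    have hHx : H ∈ lowerPolar F.filterIdealExtension.N {K | x ∈ reach 𝒰 .one K} := by
      rintro K ⟨c, hcK, hxc⟩
      exact ⟨c, (hH c).2 hxc, hcK⟩
    obtain ⟨c, hcH, htc⟩ := ht hHx
    exact (mem_upperPolar_singleton _).2
      ((mem_ultraSide_iff_forall_orient 𝒰 (e := .one)).1 ((hH c).1 hcH) t htc)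
  · simp only [hpull]
    exact (lowerPolar_reach_lowerPolar_starRel 𝒰
      (F.filterIdealExtension.RF_stable_zero f H)).trans
      (rel0_ultraRel_core h𝒰 (h := F.complexAlgebra.opF f) (fun _ => rfl) H).symm
  · simp only [hpull]
    exact (lowerPolar_reach_upperPolar_starRel 𝒰
      (F.filterIdealExtension.RG_stable_zero g K)).trans
      (rel0_ultraRel_core h𝒰 (h := F.complexAlgebra.opG g) (fun _ => rfl) K).symm
  -- Cores of filters recover the extent of `c` from its image, so equal images force equal
  -- concepts.
  · have key : ∀ (c : F.filterIdealExtension.Cpx) (H : Order.PFilter F.Cpx), H ∈ c.extent ↔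
        core 𝒰 .one H ⊆ lowerPolar (fun w K => w ∈ reach 𝒰 .one K) c.intent := by
      intro c H
      rw [← c.lowerPolar_intent]
      exact ⟨fun h x hx K hK => (core_subset_reach_iff_meets h𝒰).2 (h hK) hx,
        fun h K hK => (core_subset_reach_iff_meets h𝒰).1 fun x hx => h hx hK⟩
    refine Concept.ext (Set.ext fun H => ?_)
    exact (key a H).trans ((iff_of_eq (congrArg _ heq)).trans (key b H).symm)

theorem mainTheorem2 {L : LESignature.{v}} (F : LEFrame.{u, v} L) :
    ∃ (J : Type u) (𝒰 : Ultrafilter J)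
      (S : (F.ultrapower 𝒰).W → F.filterIdealExtension.U → Prop)
      (T : (F.ultrapower 𝒰).U → F.filterIdealExtension.W → Prop),
      IsSurjectivePMorphism S T ∧
      (∀ (s : J → F.W) (I : Order.Ideal F.Cpx),
        S (s : Filter.Germ (𝒰 : Filter J) F.W) I ↔ ∃ c ∈ I, {j | s j ∈ c.extent} ∈ 𝒰) ∧
      (∀ (t : J → F.U) (H : Order.PFilter F.Cpx),
        T (t : Filter.Germ (𝒰 : Filter J) F.U) H ↔ ∃ c ∈ H, {j | t j ∈ c.intent} ∈ 𝒰) := by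
  -- The factor `ℕ` makes the index set infinite even for a finite complex algebra, and supplies the
  -- tags in the saturation arguments.
  obtain ⟨J, 𝒰, h𝒰⟩ := exists_isSaturating (ℕ × F.Cpx)
  exact ⟨J, 𝒰, _, _, isSurjectivePMorphism_reach F h𝒰, fun _ _ => Iff.rfl, fun _ _ => Iff.rfl⟩
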